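/- Let $G=(V,E)$ be a $d$-graph: a graph whose vertices are points of $\mathbb R^d$ and whose edges are line segments joining pairs of vertices, which is invariant under translation by the canonical basis vectors, has finite degree $d_v$ at every vertex $v$, and has finitely many vertices in every bounded region. Let $T:[0,\infty)\to[0,\infty)$ be a Borel measurable temperature profile. For $k\in\mathbb N$, $k\ge 1$, let $\mathcal A_k$ be the collection of nonempty connected sets $A\subset V$ with $|A|\le k$. For interactions $\mathcal J\in\{-1,+1\}^E$, a configuration $\sigma\in\{-1,+1\}^V$ and a finite $A\subset V$ put $$\Delta_A\mathcal H_{\mathcal J}(\sigma)=2\sum_{e=\{x,y\}\in E:\,x\in A,\;y\notin A}J_e\,\sigma_x\sigma_y ,\qquad c^{\mathcal J,T,(A)}_t(\sigma)=\frac{1}{1+e^{2\Delta_A\mathcal H_{\mathcal J}(\sigma)/T(t)}}\ \text{ if } T(t)>0,$$ and, if $T(t)=0$, let $c^{\mathcal J,T,(A)}_t(\sigma)$ be $0$, $\tfrac12$ or $1$ according to whether $\Delta_A\mathcal H_{\mathcal J}(\sigma)$ is positive, zero or negative. The $(k,\langle\mathcal J\rangle,\langle\sigma\rangle;T)$-model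 on $G$ is the left-continuous $\{-1,+1\}^V$-valued process $(\sigma(t))_{t\ge 0}$ with $\sigma(0)=\sigma$ given by the following graphical representation. Each $A\in\mathcal A_k$ carries a Poisson process of rate $1$ with arrivals $\tau_{A,1}<\tau_{A,2}<\cdots$ and variables $U_{A,1},U_{A,2},\dots$ uniform on $[0,1]$, all independent. At time $t=\tau_{A,n}$ all the spins in $A$ are flipped if $U_{A,n}<c^{\mathcal J,T,(A)}_t(\sigma(t))$, and there is no flip at $A$ otherwise. Let $\mathcal N_x$ be the set of the times of all flips at sets $A\in\mathcal A_k$ with $x\in A$, and let $\mathcal N^-_x\subset\mathcal N_x$ be the set of the times of those flips for which $\Delta_A\mathcal H_{\mathcal J}(\sigma(t))>0$. The profile $T$ is called fast decreasing to zero (on $G$) if, for all $x\in V$, $k\ge1$ and $\mathcal J\in\{-1,+1\}^E$, $$\lim_{t\to\infty}\ \sup_{\hat\sigma\in\{-1,+1\}^V}\mathbb E\big(|\mathcal N_x^-\cap[t,\infty)|\ \big|\ \sigma(t)=\hat\sigma\big)=0 ,$$ where the conditional expectation given $\sigma(t)=\hat\sigma$ is the expectation for the process started at time $t$ from $\hat\sigma$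 and driven by the arrivals from time $t$ on. **Theorem.** 1. If $\limsup_{t\to\infty}T(t)\ln t<4$, then $T$ is fast decreasing to zero. 2. If $x\in V$ is such that $\liminf_{t\to\infty}T(t)\ln t>4d_x$ (the value $+\infty$ being allowed for the lower limit), then, for all $k\ge1$, $\mathcal J\in\{-1,+1\}^E$ and $\sigma\in\{-1,+1\}^V$, in the $(k,\langle\mathcal J\rangle,\langle\sigma\rangle;T)$-model the set $\mathcal N_x$ is infinite almost surely. -/

import Mathlib

open MeasureTheory ProbabilityTheory Filter Topology
open scoped NNReal ENNReal

noncomputable section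

namespace Ising

/-! ## Periodic graphs in Euclidean space -/

/-- A graph embedded in `ℝ^d`: its vertices are points of `ℝ^d`, its edges are (the line segments
between) pairs of distinct vertices. It is invariant under the translations by the vectors of the
canonical basis, every vertex has finite degree, and bounded regions contain finitely many
vertices. -/
structure DGraph (d : ℕ) where
  /-- the set of vertices -/
  verts : Set (EuclideanSpace ℝ (Fin d))
  /-- the edges -/
  graph : SimpleGraph verts
  translate_verts : ∀ (i : Fin d) (p : EuclideanSpace ℝ (Fin d)),
    p ∈ verts ↔ p + EuclideanSpace.single i (1 : ℝ) ∈ verts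
  translate_adj : ∀ (i : Fin d) (u v u' v' : verts),
    (u' : EuclideanSpace ℝ (Fin d)) =
      (u : EuclideanSpace ℝ (Fin d)) + EuclideanSpace.single i (1 : ℝ) →
    (v' : EuclideanSpace ℝ (Fin d)) =
      (v : EuclideanSpace ℝ (Fin d)) + EuclideanSpace.single i (1 : ℝ) →
    (graph.Adj u v ↔ graph.Adj u' v')
  finite_degree : ∀ v : verts, (graph.neighborSet v).Finite
  finite_of_bounded : ∀ S : Set (EuclideanSpace ℝ (Fin d)), Bornology.IsBounded S →
    (verts ∩ S).Finite

variable {d : ℕ} (G : DGraph d)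

/-- The type of vertices. -/
abbrev DGraph.V : Type := G.verts

/-- The type of edges. -/
abbrev DGraph.E : Type := G.graph.edgeSet

/-- The degree `d_v` of a vertex. -/
def DGraph.deg (v : G.V) : ℕ := (G.graph.neighborSet v).ncard

/-- Spin configurations, elements of `{-1,+1}^V` (`ℤˣ` is the two-element set `{1, -1}`). -/
abbrev DGraph.Config : Type := G.V → ℤˣ

/-- Interactions, elements of `{-1,+1}^E`. -/
abbrev DGraph.Interactions : Type := G.E → ℤˣ

/-- The boundary `∂A` of `A`. -/
def DGraph.bdry (A : Set G.V) : Set G.V := {v | v ∈ A ∧ ∃ u, u ∉ A ∧ G.graph.Adj u v}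

/-- The external boundary `∂^{ext}A` of `A`. -/
def DGraph.extBdry (A : Set G.V) : Set G.V := {v | v ∉ A ∧ ∃ u, u ∈ A ∧ G.graph.Adj u v}

/-- The edges `{x, y}` with `x ∈ ∂A` and `y ∈ ∂^{ext}A`. -/
def DGraph.cut (A : Set G.V) : Set G.E :=
  {e | ∃ x ∈ G.bdry A, ∃ y ∈ G.extBdry A, (e : Sym2 G.V) = s(x, y)}

variable {G}

/-- The product `σ_x σ_y` of the spins at the two endpoints of the edge `e = {x, y}`. -/
def spinProd (σ : G.Config) (e : G.E) : ℤˣ :=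
  Sym2.lift ⟨fun x y => σ x * σ y, fun _ _ => mul_comm _ _⟩ (e : Sym2 G.V)

/-- The increment `Δ_A H_J(σ) = 2 ∑ J_e σ_x σ_y` of the Hamiltonian at `A`, the sum being over the
edges `e = {x, y}` with `x ∈ ∂A`, `y ∈ ∂^{ext}A` (finitely many when `A` is finite). -/
def deltaH (J : G.Interactions) (A : Set G.V) (σ : G.Config) : ℤ :=
  2 * ∑ᶠ e ∈ G.cut A, ((J e * spinProd σ e : ℤˣ) : ℤ)

/-- The flip rate at temperature `θ` when the increment of the Hamiltonian is `δ`: for `θ > 0` it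
is `1 / (1 + exp (2 δ / θ))`; for `θ = 0` it is the limit of this as `θ → 0⁺`. -/
def rate (θ : ℝ≥0) (δ : ℤ) : ℝ :=
  if θ = 0 then (if 0 < δ then 0 else if δ = 0 then 1 / 2 else 1)
  else 1 / (1 + Real.exp (2 * (δ : ℝ) / (θ : ℝ)))

variable (G)

/-- The collection `𝒜_k` of the (nonempty) connected sets of at most `k` vertices. -/
def Region (k : ℕ) : Type :=
  {A : Finset G.V // A.card ≤ k ∧ (G.graph.induce (A : Set G.V)).Connected}

/-! ## The graphical representation -/

/-- The sample space of the graphical representation: to each `A ∈ 𝒜_k` and `n ∈ ℕ` belong an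
interarrival time and a mark in `[0,1]`. -/
abbrev Sample (k : ℕ) : Type := Region G k × ℕ → ℝ × unitInterval

instance isProbabilityMeasure_exp_one : IsProbabilityMeasure (expMeasure 1) := isProbabilityMeasure_expMeasure one_pos

/-- The law of the graphical representation: all interarrival times are exponential of rate `1`
(so that the arrivals at the different `A` form Poisson processes of rate `1`), all marks are
uniform on `[0,1]`, and all of them are independent. -/
def harrisMeasure (k : ℕ) : Measure (Sample G k) :=
  Measure.infinitePi fun _ : Region G k × ℕ => (expMeasure 1).prod (volume : Measure unitInterval)

variable {G} {k : ℕ}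

/-- The arrival time `τ_{A,n}` (with `n` counted from `0`). -/
def arrival (ω : Sample G k) (A : Region G k) (n : ℕ) : ℝ≥0 :=
  ∑ i ∈ Finset.range (n + 1), (ω (A, i)).1.toNNReal

/-- The mark `U_{A,n}`. -/
def mark (ω : Sample G k) (A : Region G k) (n : ℕ) : ℝ := (ω (A, n)).2

/-- If the configuration just before time `r` is `η`, then there is a flip at `A` at time `r`: the
time `r` is an arrival `τ_{A,n}`, and `U_{A,n}` is smaller than the flip rate. -/
def FlipAt (T : ℝ≥0 → ℝ≥0) (J : G.Interactions) (ω : Sample G k) (A : Region G k)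
    (r : ℝ≥0) (η : G.Config) : Prop :=
  ∃ n, arrival ω A n = r ∧ mark ω A n < rate (T r) (deltaH J (A.1 : Set G.V) η)

open Classical in
/-- The configuration just after time `r`, given the configuration `η` just before, in the dynamics
that uses only the clocks of the sets in `S`. (Almost surely there are no two arrivals at the same
time, so that at most one set flips.) -/
def step (T : ℝ≥0 → ℝ≥0) (J : G.Interactions) (ω : Sample G k) (S : Finset (Region G k))
    (η : G.Config) (r : ℝ≥0) : G.Config :=
  fun v => if ∃ A ∈ S, v ∈ A.1 ∧ FlipAt T J ω A r η then -η v else η v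

/-- The arrival times in `[s, t)` of the clocks of the sets in `S`. -/
def arrivalTimes (ω : Sample G k) (S : Finset (Region G k)) (s t : ℝ≥0) : Set ℝ≥0 :=
  {r | s ≤ r ∧ r < t ∧ ∃ A ∈ S, ∃ n, arrival ω A n = r}

open Classical in
/-- The configuration at time `t` of the dynamics that starts at time `s` from `ξ` and uses only the
clocks of the sets in the finite collection `S`: starting from `ξ`, the finitely many arrivals in
`[s, t)` are treated in chronological order. (Almost surely the arrivals in `[s, t)` are finitely
many.) -/
def finiteProcess (T : ℝ≥0 → ℝ≥0) (J : G.Interactions) (ω : Sample G k) (S : Finset (Region G k))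
    (s : ℝ≥0) (ξ : G.Config) (t : ℝ≥0) : G.Config :=
  if h : (arrivalTimes ω S s t).Finite then
    (h.toFinset.sort (· ≤ ·)).foldl (step T J ω S) ξ
  else ξ

open Classical in
/-- The process `σ(t)`, `t ≥ s`, started at time `s` from the configuration `ξ`. It is the limit of
the dynamics that use finitely many clocks, as the finite collection of clocks increases to `𝒜_k`.
(Almost surely, the spin at any vertex and any time is eventually constant along this limit, and
`σ` has left-continuous trajectories that flip exactly as `FlipAt` prescribes.) -/
def process (T : ℝ≥0 → ℝ≥0) (J : G.Interactions) (s : ℝ≥0) (ξ : G.Config) (ω : Sample G k)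
    (t : ℝ≥0) : G.Config :=
  fun v => if ∀ᶠ S : Finset (Region G k) in atTop, finiteProcess T J ω S s ξ t v = 1
    then 1 else -1

/-- The set of the times `r ≥ s` at which there is a flip at `A` in the process started at time `s`
from `ξ`, with an increment of the Hamiltonian satisfying `p`. -/
def flipTimes (T : ℝ≥0 → ℝ≥0) (J : G.Interactions) (s : ℝ≥0) (ξ : G.Config) (ω : Sample G k)
    (p : ℤ → Prop) (A : Region G k) : Set ℝ≥0 :=
  {r | s ≤ r ∧ FlipAt T J ω A r (process T J s ξ ω r) ∧
    p (deltaH J (A.1 : Set G.V) (process T J s ξ ω r))}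

/-- `𝒩⁻_x`: the times of the flips involving `x` in opposition of the Hamiltonian. -/
def oppositionFlips (T : ℝ≥0 → ℝ≥0) (J : G.Interactions) (s : ℝ≥0) (ξ : G.Config)
    (ω : Sample G k) (x : G.V) : Set ℝ≥0 :=
  ⋃ A ∈ {A : Region G k | x ∈ A.1}, flipTimes T J s ξ ω (fun δ => 0 < δ) A

/-- `𝒩⁰_x`: the times of the flips involving `x` that are indifferent for the Hamiltonian. -/
def indifferentFlips (T : ℝ≥0 → ℝ≥0) (J : G.Interactions) (s : ℝ≥0) (ξ : G.Config)
    (ω : Sample G k) (x : G.V) : Set ℝ≥0 :=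
  ⋃ A ∈ {A : Region G k | x ∈ A.1}, flipTimes T J s ξ ω (fun δ => δ = 0) A

/-- `𝒩⁺_x`: the times of the flips involving `x` in favour of the Hamiltonian. -/
def favourFlips (T : ℝ≥0 → ℝ≥0) (J : G.Interactions) (s : ℝ≥0) (ξ : G.Config)
    (ω : Sample G k) (x : G.V) : Set ℝ≥0 :=
  ⋃ A ∈ {A : Region G k | x ∈ A.1}, flipTimes T J s ξ ω (fun δ => δ < 0) A

/-- `𝒩_x`: the times of all the flips involving `x`. -/
def totalFlips (T : ℝ≥0 → ℝ≥0) (J : G.Interactions) (s : ℝ≥0) (ξ : G.Config)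
    (ω : Sample G k) (x : G.V) : Set ℝ≥0 :=
  oppositionFlips T J s ξ ω x ∪ indifferentFlips T J s ξ ω x ∪ favourFlips T J s ξ ω x

/-- `𝔼 (|𝒩⁻_x ∩ [t, ∞)| | σ(t) = ξ)`. Since `σ(t)` depends only on the arrivals before time `t`,
the conditional law of the process after time `t` is that of the process started at time `t`
from `ξ` and driven by the arrivals after time `t`. -/
def expectedOpposition (T : ℝ≥0 → ℝ≥0) (k : ℕ) (J : G.Interactions) (x : G.V) (t : ℝ≥0)
    (ξ : G.Config) : ℝ≥0∞ :=
  ∫⁻ ω : Sample G k, (((oppositionFlips T J t ξ ω x ∩ Set.Ici t).encard : ℕ∞) : ℝ≥0∞)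
    ∂(harrisMeasure G k)

variable (G)

/-- The temperature profile `T` is fast decreasing to zero (for the graph `G`). -/
def FastDecreasing (T : ℝ≥0 → ℝ≥0) : Prop :=
  ∀ (x : G.V) (k : ℕ), 1 ≤ k → ∀ J : G.Interactions,
    Tendsto (fun t : ℝ≥0 => ⨆ ξ : G.Config, expectedOpposition T k J x t ξ) atTop (𝓝 0)

end Ising

end

/-!
The flip rate at time `t` depends on the current configuration only through the increment `δ` of the
Hamiltonian, and both parts follow from bounds on this rate that are uniform in the configuration.
They reduce the two claims to statements about the clocks and marks of the graphical representation,
which are explicit independent random variables; no property of the process is needed.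

*Part 1.* The increment is an even integer, so a flip in opposition has `δ ≥ 2`. If
`T(t) log t < a < 4` for large `t`, its rate is at most `exp (-4 / T(t)) ≤ t ^ (-p)` with
`p = 4 / a > 1` (`rate_le_rpow`). Hence the number of flips in opposition at `x` after time `t` is at
most the number of pairs `(A, n)` with `x ∈ A`, `τ_{A,n} ≥ t` and `U_{A,n} < τ_{A,n} ^ (-p)`
(`encard_oppositionFlips_le`). For fixed `A` such a pair has probability at most `t ^ (-p)`. By
Chernoff's bound `τ_{A,n}` exceeds `(n + 1) / 2` outside an event of exponentially small probability,
so the probability is also at most a summable sequence independent of `t` (`measure_late_le`).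
Dominated convergence makes the expected number of pairs tend to `0`, because only finitely many
regions contain `x` (`finite_region_mem`). The bound does not depend on the starting configuration.

*Part 2.* The set `{x}` is a region, and its boundary has `d_x` edges, so `δ ≤ 2 d_x`. If
`T(t) log t > a > 4 d_x` for large `t`, then the rate at `{x}` is at least `t ^ (-b) / 2` with
`b = 4 d_x / a < 1` (`rpow_le_rate`). Almost surely `τ_{{x},n} < 2 (n + 1)` for large `n`, by
Chernoff's bound and the first Borel–Cantelli lemma (`ae_eventually_arrival`). The independent events
`U_{{x},n} < (2 (n + 1)) ^ (-b) / 2` have divergent total probability, so infinitely many of them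
occur by the second Borel–Cantelli lemma (`ae_frequently_mark_lt`), and all but finitely many of
those produce a flip of `x`.
-/

namespace Ising

variable {d : ℕ} {G : DGraph d} {k : ℕ}

/-! ### Regions through a vertex -/

lemma finite_setOf_walk_length (x : G.V) (n : ℕ) :
    {y | ∃ p : G.graph.Walk x y, p.length = n}.Finite := by
  induction n with
  | zero =>
    refine (Set.finite_singleton x).subset ?_
    rintro y ⟨p, hp⟩
    exact (SimpleGraph.Walk.eq_of_length_eq_zero hp).symm
  | succ n ih =>
    refine (ih.biUnion fun z _ => G.finite_degree z).subset ?_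
    rintro y ⟨p, hp⟩
    have hnil : ¬ p.Nil := by
      rw [← SimpleGraph.Walk.length_eq_zero_iff]; omega
    simp only [Set.mem_iUnion]
    refine ⟨p.penultimate, ⟨p.dropLast, ?_⟩, p.adj_penultimate hnil⟩
    have := p.length_dropLast_add_one hnil
    omega

/-- A connected set of at most `k` vertices containing `x` lies in the ball of radius `k` around
`x`, which is finite because all degrees are. -/
lemma finite_region_mem (x : G.V) (k : ℕ) : Finite {A : Region G k // x ∈ A.1} := by
  classical
  have hB : (⋃ n ∈ Finset.range k, {y | ∃ p : G.graph.Walk x y, p.length = n}).Finite :=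
    (Finset.range k).finite_toSet.biUnion fun n _ => finite_setOf_walk_length x n
  have key : ∀ A : {A : Region G k // x ∈ A.1}, A.1.1 ∈ hB.toFinset.powerset := by
    rintro ⟨⟨A, hcard, hconn⟩, hx⟩
    rw [Finset.mem_powerset]
    intro y hy
    rw [Set.Finite.mem_toFinset]
    obtain ⟨p, hp⟩ := hconn.exists_isPath (⟨x, hx⟩ : (A : Set G.V)) ⟨y, hy⟩
    have hlt : p.length < A.card := by simpa using hp.length_lt
    simp only [Set.mem_iUnion]
    exact ⟨p.length, by simpa using hlt.trans_le hcard,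
      p.map (SimpleGraph.Embedding.induce _).toHom, SimpleGraph.Walk.length_map _ _⟩
  refine Finite.of_injective (β := hB.toFinset.powerset) (fun A => ⟨A.1.1, key A⟩) ?_
  intro A B h
  exact Subtype.ext (Subtype.ext (Subtype.mk.inj h))

/-! ### Flip rates -/

lemma two_le_deltaH_of_pos {J : G.Interactions} {A : Set G.V} {σ : G.Config}
    (h : 0 < deltaH J A σ) : 2 ≤ deltaH J A σ := by
  unfold deltaH at *
  omega

lemma deltaH_singleton_le (J : G.Interactions) (x : G.V) (σ : G.Config) :
    deltaH J {x} σ ≤ 2 * (G.deg x : ℤ) := by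
  have hsub : (Subtype.val '' G.cut {x}) ⊆ (fun y => s(x, y)) '' G.graph.neighborSet x := by
    rintro _ ⟨e, ⟨u, hu, v, ⟨-, w, hw, hadj⟩, he⟩, rfl⟩
    obtain rfl : u = x := hu.1
    obtain rfl : w = u := hw
    exact ⟨v, hadj, he.symm⟩
  have hfin : (G.cut {x}).Finite :=
    Set.Finite.of_finite_image (((G.finite_degree x).image _).subset hsub)
      Subtype.val_injective.injOn
  have hcard : (G.cut {x}).ncard ≤ G.deg x := by
    rw [← Set.ncard_image_of_injective _ Subtype.val_injective]
    exact (Set.ncard_le_ncard hsub ((G.finite_degree x).image _)).trans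
      (Set.ncard_image_le (G.finite_degree x))
  unfold deltaH
  rw [finsum_mem_eq_finite_toFinset_sum _ hfin]
  have hsum : ∑ e ∈ hfin.toFinset, ((J e * spinProd σ e : ℤˣ) : ℤ) ≤ (G.deg x : ℤ) := by
    refine (Finset.sum_le_card_nsmul _ _ 1 fun e _ => ?_).trans ?_
    · rcases Int.units_eq_one_or (J e * spinProd σ e) with h | h <;> simp [h]
    · rw [nsmul_one, ← Set.ncard_eq_toFinset_card _ hfin]
      exact_mod_cast hcard
  linarith

/-- If `θ log r ≤ a`, then energy increments of at least `2` are accepted at temperature `θ` with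
probability at most `r ^ (-4 / a)`. -/
lemma rate_le_rpow {θ : ℝ≥0} {δ : ℤ} (hδ : 2 ≤ δ) {r a : ℝ} (hr : 0 < r) (ha : 0 < a)
    (h : θ * Real.log r ≤ a) : rate θ δ ≤ r ^ (-(4 / a)) := by
  unfold rate
  split_ifs with h0 h1 h2
  · positivity
  · omega
  · omega
  · have hθ : (0 : ℝ) < θ := by exact_mod_cast pos_iff_ne_zero.2 h0
    have hδ' : (2 : ℝ) ≤ δ := by exact_mod_cast hδ
    rw [Real.rpow_def_of_pos hr]
    calc 1 / (1 + Real.exp (2 * δ / θ)) ≤ 1 / Real.exp (2 * δ / θ) :=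
          one_div_le_one_div_of_le (Real.exp_pos _) (by linarith [Real.exp_pos (2 * δ / (θ : ℝ))])
      _ = Real.exp (-(2 * δ / θ)) := by rw [Real.exp_neg, one_div]
      _ ≤ Real.exp (Real.log r * -(4 / a)) := by
        rw [Real.exp_le_exp, mul_neg, neg_le_neg_iff]
        calc Real.log r * (4 / a) ≤ 4 / θ := by
              rw [← mul_div_assoc, div_le_div_iff₀ ha hθ]
              linarith
          _ ≤ 2 * δ / θ := by gcongr; linarith

/-- If `a ≤ θ log r`, then energy increments of at most `2 D` are accepted at temperature `θ` with
probability at least `r ^ (-4 D / a) / 2`. -/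
lemma rpow_le_rate {θ : ℝ≥0} {δ : ℤ} {D : ℕ} (hδ : δ ≤ 2 * D) {r a : ℝ} (hr : 1 ≤ r) (ha : 0 < a)
    (h : a ≤ θ * Real.log r) : 1 / 2 * r ^ (-(4 * D / a)) ≤ rate θ δ := by
  have hθ : (0 : ℝ) < θ := by
    rcases eq_or_lt_of_le θ.coe_nonneg with h0 | h0
    · rw [← h0, zero_mul] at h; linarith
    · exact h0
  have hδ' : (δ : ℝ) ≤ 2 * D := by exact_mod_cast hδ
  have h1 : Real.exp (2 * δ / θ) ≤ r ^ (4 * D / a) := by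
    rw [Real.rpow_def_of_pos (by linarith), Real.exp_le_exp]
    calc 2 * (δ : ℝ) / θ ≤ 4 * (D : ℝ) / θ := by gcongr ?_ / _; linarith
      _ ≤ Real.log r * (4 * D / a) := by
        rw [← mul_div_assoc, div_le_div_iff₀ hθ ha]
        have hD : (0 : ℝ) ≤ 4 * D := by positivity
        nlinarith
  have h2 : 1 ≤ r ^ (4 * D / a) := Real.one_le_rpow hr (by positivity)
  rw [rate, if_neg (by rintro rfl; simp at hθ), Real.rpow_neg (by linarith), ← one_div,
    one_div_mul_one_div]
  exact one_div_le_one_div_of_le (by positivity) (by linarith)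

/-! ### Tails of the arrival times and marks -/

/-- The moment generating function of the exponential distribution. The positive part is taken
because the arrival times are built from the positive parts of the interarrival times. -/
lemma integrable_exp_mul_toNNReal {t : ℝ} (ht : t < 1) :
    Integrable (fun x : ℝ => Real.exp (t * (x.toNNReal : ℝ))) (expMeasure 1) ∧
      ∫ x, Real.exp (t * (x.toNNReal : ℝ)) ∂(expMeasure 1) = 1 / (1 - t) := by
  have hmeas : Measurable (exponentialPDF 1) := by
    unfold exponentialPDF; fun_prop
  have hE : expMeasure 1 = volume.withDensity (exponentialPDF 1) := rfl
  have hlt : ∀ᵐ x : ℝ, exponentialPDF 1 x < ∞ := ae_of_all _ fun x => ENNReal.ofReal_lt_top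
  have hfun : (fun x : ℝ => (exponentialPDF 1 x).toReal • Real.exp (t * (x.toNNReal : ℝ))) =
      (Set.Ici 0).indicator fun x => Real.exp ((t - 1) * x) := by
    funext x
    rcases le_or_gt 0 x with hx | hx
    · rw [Set.indicator_of_mem (Set.mem_Ici.2 hx), exponentialPDF_of_nonneg hx,
        ENNReal.toReal_ofReal (by positivity), Real.coe_toNNReal x hx, smul_eq_mul, one_mul, one_mul,
        ← Real.exp_add]
      congr 1; ring
    · rw [Set.indicator_of_notMem (by simpa using hx), exponentialPDF_of_neg hx]
      simp
  constructor
  · rw [hE, integrable_withDensity_iff_integrable_smul' hmeas hlt, hfun,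
      integrable_indicator_iff measurableSet_Ici, integrableOn_Ici_iff_integrableOn_Ioi]
    exact integrableOn_exp_mul_Ioi (by linarith) 0
  · rw [hE, integral_withDensity_eq_integral_toReal_smul hmeas hlt, hfun,
      integral_indicator measurableSet_Ici, integral_Ici_eq_integral_Ioi,
      integral_exp_mul_Ioi (by linarith)]
    rw [mul_zero, Real.exp_zero, ← neg_sub 1 t, neg_div_neg_eq]

instance : IsProbabilityMeasure (harrisMeasure G k) := by
  unfold harrisMeasure; infer_instance

@[fun_prop]
lemma measurable_arrival (A : Region G k) (n : ℕ) :
    Measurable fun ω : Sample G k => arrival ω A n := by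
  unfold arrival; fun_prop

@[fun_prop]
lemma measurable_mark (A : Region G k) (n : ℕ) :
    Measurable fun ω : Sample G k => mark ω A n := by
  unfold mark; fun_prop

lemma measurePreserving_eval (A : Region G k) (n : ℕ) :
    MeasurePreserving (fun ω : Sample G k => ω (A, n)) (harrisMeasure G k)
      ((expMeasure 1).prod (volume : Measure unitInterval)) :=
  measurePreserving_eval_infinitePi _ (A, n)

lemma integrable_exp_mul_arrival (A : Region G k) (n : ℕ) {t : ℝ} (ht : t < 1) :
    Integrable (fun ω => Real.exp (t * (arrival ω A n : ℝ))) (harrisMeasure G k) ∧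
      mgf (fun ω => (arrival ω A n : ℝ)) (harrisMeasure G k) t = (1 / (1 - t)) ^ (n + 1) := by
  set X : ℕ → Sample G k → ℝ := fun i ω => ((ω (A, i)).1.toNNReal : ℝ) with hX
  have hind : iIndepFun X (harrisMeasure G k) :=
    (iIndepFun_infinitePi (P := fun _ : Region G k × ℕ =>
      (expMeasure 1).prod (volume : Measure unitInterval))
      (X := fun _ z => (z.1.toNNReal : ℝ)) (by fun_prop)).precomp (g := fun i : ℕ => (A, i))
      (Prod.mk_right_injective A)
  have hmeas : ∀ i, Measurable (X i) := fun i => by fun_prop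
  have hsum : (fun ω => (arrival ω A n : ℝ)) = ∑ i ∈ Finset.range (n + 1), X i := by
    funext ω; simp [arrival, hX]
  have hp : ∀ i, MeasurePreserving (fun ω : Sample G k => (ω (A, i)).1) (harrisMeasure G k)
      (expMeasure 1) := fun i => measurePreserving_fst.comp (measurePreserving_eval A i)
  have hXint : ∀ i, Integrable (fun ω => Real.exp (t * X i ω)) (harrisMeasure G k) := fun i =>
    (hp i).integrable_comp_of_integrable (integrable_exp_mul_toNNReal ht).1
  have hXmgf : ∀ i, mgf (X i) (harrisMeasure G k) t = 1 / (1 - t) := fun i => by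
    rw [← (integrable_exp_mul_toNNReal ht).2, ← (hp i).map_eq,
      integral_map (hp i).measurable.aemeasurable (by fun_prop)]
    rfl
  constructor
  · have := hind.integrable_exp_mul_sum hmeas (s := Finset.range (n + 1)) fun i _ => hXint i
    rwa [← hsum] at this
  · rw [hsum, hind.mgf_sum hmeas]
    simp [hXmgf]

/-- Chernoff's bound for the lower tail, with parameter `-1`: `𝔼 exp (-τ) = 2 ^ (-(n + 1))`. -/
lemma measure_arrival_le (A : Region G k) (n : ℕ) :
    harrisMeasure G k {ω | (arrival ω A n : ℝ) ≤ (n + 1) / 2} ≤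
      ENNReal.ofReal ((Real.exp (1 / 2) / 2) ^ (n + 1)) := by
  obtain ⟨hint, hmgf⟩ := integrable_exp_mul_arrival A n (t := -1) (by norm_num)
  rw [← ofReal_measureReal]
  refine ENNReal.ofReal_le_ofReal
    ((measure_le_le_exp_mul_mgf ((n + 1 : ℝ) / 2) (by norm_num) hint).trans_eq ?_)
  have h : Real.exp (- -1 * ((n + 1 : ℝ) / 2)) = Real.exp (1 / 2) ^ (n + 1) := by
    rw [← Real.exp_nat_mul]
    push_cast
    congr 1; ring
  rw [hmgf, h, ← mul_pow]
  norm_num [div_eq_mul_inv]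

/-- Chernoff's bound for the upper tail, with parameter `1 / 2`: `𝔼 exp (τ / 2) = 2 ^ (n + 1)`. -/
lemma measure_le_arrival (A : Region G k) (n : ℕ) :
    harrisMeasure G k {ω | (2 * (n + 1) : ℝ) ≤ arrival ω A n} ≤
      ENNReal.ofReal ((2 / Real.exp 1) ^ (n + 1)) := by
  obtain ⟨hint, hmgf⟩ := integrable_exp_mul_arrival A n (t := 1 / 2) (by norm_num)
  rw [← ofReal_measureReal]
  refine ENNReal.ofReal_le_ofReal
    ((measure_ge_le_exp_mul_mgf (2 * (n + 1) : ℝ) (by norm_num) hint).trans_eq ?_)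
  have h : Real.exp (-(1 / 2) * (2 * (n + 1 : ℝ))) = (Real.exp 1)⁻¹ ^ (n + 1) := by
    rw [← Real.exp_neg, ← Real.exp_nat_mul]
    push_cast
    congr 1; ring
  rw [hmgf, h, ← mul_pow, mul_comm]
  norm_num [div_eq_mul_inv]

lemma summable_exp_half_div_two_pow :
    Summable fun n : ℕ => (Real.exp (1 / 2) / 2) ^ (n + 1) := by
  refine (summable_nat_add_iff 1).2 (summable_geometric_of_lt_one (by positivity) ?_)
  have h : Real.exp (1 / 2) ^ 2 < 2 ^ 2 := by
    rw [← Real.exp_nat_mul]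
    norm_num
    linarith [Real.exp_one_lt_d9]
  have := lt_of_pow_lt_pow_left₀ 2 (by norm_num) h
  linarith

lemma summable_two_div_exp_pow : Summable fun n : ℕ => (2 / Real.exp 1) ^ (n + 1) := by
  refine (summable_nat_add_iff 1).2 (summable_geometric_of_lt_one (by positivity) ?_)
  rw [div_lt_one (Real.exp_pos _)]
  linarith [Real.exp_one_gt_d9]

/-- Almost surely, the `n`-th arrival time of a clock is of order `n`. -/
lemma ae_eventually_arrival (A : Region G k) : ∀ᵐ ω ∂(harrisMeasure G k), ∀ᶠ n : ℕ in atTop,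
    ((n + 1 : ℝ) / 2 < arrival ω A n ∧ (arrival ω A n : ℝ) < 2 * (n + 1)) := by
  have h1 := ae_eventually_notMem (ne_top_of_le_ne_top
    summable_exp_half_div_two_pow.tsum_ofReal_ne_top (ENNReal.tsum_le_tsum (measure_arrival_le A)))
  have h2 := ae_eventually_notMem (ne_top_of_le_ne_top
    summable_two_div_exp_pow.tsum_ofReal_ne_top (ENNReal.tsum_le_tsum (measure_le_arrival A)))
  filter_upwards [h1, h2] with ω h1 h2
  filter_upwards [h1, h2] with n h1 h2
  exact ⟨not_le.1 h1, not_le.1 h2⟩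

lemma measurePreserving_mark (A : Region G k) (n : ℕ) :
    MeasurePreserving (fun ω : Sample G k => mark ω A n) (harrisMeasure G k)
      (volume.restrict unitInterval) :=
  unitInterval.measurePreserving_coe.comp
    (measurePreserving_snd.comp (measurePreserving_eval A n))

lemma measure_mark_lt_le (A : Region G k) (n : ℕ) (u : ℝ) :
    harrisMeasure G k {ω | mark ω A n < u} ≤ ENNReal.ofReal u := by
  have h := (measurePreserving_mark A n).measure_preimage
    (measurableSet_Iio (a := u)).nullMeasurableSet
  rw [Measure.restrict_apply measurableSet_Iio] at h
  refine h.trans_le ((measure_mono ?_).trans_eq ((Real.volume_Ico (a := 0) (b := u)).trans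
    (by rw [sub_zero])))
  exact fun y hy => ⟨hy.2.1, hy.1⟩

lemma measure_mark_lt (A : Region G k) (n : ℕ) {u : ℝ} (hu : u ≤ 1) :
    harrisMeasure G k {ω | mark ω A n < u} = ENNReal.ofReal u := by
  refine (measure_mark_lt_le A n u).antisymm ?_
  have h := (measurePreserving_mark A n).measure_preimage
    (measurableSet_Iio (a := u)).nullMeasurableSet
  rw [Measure.restrict_apply measurableSet_Iio] at h
  refine ((Real.volume_Ico (a := 0) (b := u)).trans (by rw [sub_zero])).symm.trans_le
    ((measure_mono ?_).trans_eq h.symm)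
  exact fun y hy => ⟨hy.2, hy.1, hy.2.le.trans hu⟩

/-- The second Borel–Cantelli lemma for the marks of one clock. -/
lemma ae_frequently_mark_lt (A : Region G k) {u : ℕ → ℝ} (hu0 : ∀ n, 0 ≤ u n) (hu1 : ∀ n, u n ≤ 1)
    (hu : ¬ Summable u) :
    ∀ᵐ ω ∂(harrisMeasure G k), ∃ᶠ n in atTop, mark ω A n < u n := by
  have hind : iIndepFun (fun (i : ℕ) (ω : Sample G k) => mark ω A i) (harrisMeasure G k) :=
    (iIndepFun_infinitePi (P := fun _ : Region G k × ℕ =>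
      (expMeasure 1).prod (volume : Measure unitInterval))
      (X := fun _ z => (z.2 : ℝ)) (by fun_prop)).precomp (g := fun i : ℕ => (A, i))
      (Prod.mk_right_injective A)
  have hms : ∀ n, MeasurableSet {ω : Sample G k | mark ω A n < u n} := fun n =>
    measurable_mark A n measurableSet_Iio
  have hset : iIndepSet (fun n => {ω : Sample G k | mark ω A n < u n}) (harrisMeasure G k) := by
    rw [iIndepSet_iff_meas_biInter hms]
    intro s
    exact hind.meas_biInter fun i _ => ⟨Set.Iio (u i), measurableSet_Iio, rfl⟩
  have htop : ∑' n, harrisMeasure G k {ω | mark ω A n < u n} = ∞ := by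
    simp_rw [measure_mark_lt A _ (hu1 _)]
    by_contra h
    refine hu ((ENNReal.summable_toReal h).congr fun n => ?_)
    rw [ENNReal.toReal_ofReal (hu0 n)]
  have hone := measure_limsup_eq_one hms hset htop
  have hae := (mem_ae_iff_prob_eq_one (MeasurableSet.measurableSet_limsup hms)).2 hone
  filter_upwards [hae] with ω hω
  rwa [mem_limsup_iff_frequently_mem] at hω

/-! ### The number of flips in opposition of the Hamiltonian -/

/-- A bound on the probability that the `n`-th arrival of a clock comes after time `t` with a mark
below `τ ^ (-p)`, where `τ` is the arrival time: either `τ` is atypically small, or the mark is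
below `((n + 1) / 2) ^ (-p)`. -/
noncomputable def lateBound (p : ℝ) (n : ℕ) : ℝ :=
  (Real.exp (1 / 2) / 2) ^ (n + 1) + ((n + 1 : ℝ) / 2) ^ (-p)

lemma lateBound_nonneg (p : ℝ) (n : ℕ) : 0 ≤ lateBound p n := by
  unfold lateBound; positivity

lemma summable_lateBound {p : ℝ} (hp : 1 < p) : Summable (lateBound p) := by
  refine summable_exp_half_div_two_pow.add ?_
  have h : Summable fun n : ℕ => ((n + 1 : ℕ) : ℝ) ^ (-p) :=
    (summable_nat_add_iff 1).2 (Real.summable_nat_rpow.2 (by linarith))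
  refine (h.mul_right (2⁻¹ ^ (-p))).congr fun n => ?_
  rw [← Real.mul_rpow (by positivity) (by positivity), ← div_eq_mul_inv]
  push_cast
  rfl

lemma measure_late_le {p : ℝ} (hp : 0 < p) (A : Region G k) (n : ℕ) {t : ℝ≥0} (ht : 0 < t) :
    harrisMeasure G k {ω | t ≤ arrival ω A n ∧ mark ω A n < (arrival ω A n : ℝ) ^ (-p)} ≤
      ENNReal.ofReal (min ((t : ℝ) ^ (-p)) (lateBound p n)) := by
  rw [ENNReal.ofReal_min]
  refine le_min ?_ ?_
  · refine (measure_mono fun ω hω => ?_).trans (measure_mark_lt_le A n _)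
    exact hω.2.trans_le (Real.rpow_le_rpow_of_nonpos (by exact_mod_cast ht)
      (by exact_mod_cast hω.1) (by linarith))
  · rw [lateBound, ENNReal.ofReal_add (by positivity) (by positivity)]
    refine (measure_mono fun ω hω => ?_).trans ((measure_union_le _ _).trans
      (add_le_add (measure_arrival_le A n) (measure_mark_lt_le A n _)))
    rcases le_or_gt (arrival ω A n : ℝ) ((n + 1) / 2) with h | h
    · exact Or.inl h
    · exact Or.inr (hω.2.trans_le (Real.rpow_le_rpow_of_nonpos (by positivity) h.le (by linarith)))

/-- Dominated convergence: each term tends to `0` because of `t ^ (-p)`, and `lateBound p` is a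
summable dominating sequence. -/
lemma tendsto_tsum_min_lateBound {p : ℝ} (hp : 1 < p) :
    Tendsto (fun t : ℝ≥0 => ∑' n, ENNReal.ofReal (min ((t : ℝ) ^ (-p)) (lateBound p n)))
      atTop (𝓝 0) := by
  have hnn : ∀ (t : ℝ≥0) (n : ℕ), 0 ≤ min ((t : ℝ) ^ (-p)) (lateBound p n) := fun t n =>
    le_min (by positivity) (lateBound_nonneg p n)
  have h : Tendsto (fun t : ℝ≥0 => ∑' n, min ((t : ℝ) ^ (-p)) (lateBound p n)) atTop
      (𝓝 (∑' _ : ℕ, (0 : ℝ))) := by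
    refine tendsto_tsum_of_dominated_convergence (summable_lateBound hp) (fun n => ?_)
      (Eventually.of_forall fun t n => ?_)
    · refine squeeze_zero (fun t => hnn t n) (fun t => min_le_left _ _)
        ((tendsto_rpow_neg_atTop (by linarith)).comp (NNReal.tendsto_coe_atTop.2 tendsto_id))
    · rw [Real.norm_of_nonneg (hnn t n)]
      exact min_le_right _ _
  rw [tsum_zero] at h
  have h' := ENNReal.tendsto_ofReal h
  rw [ENNReal.ofReal_zero] at h'
  refine h'.congr fun t => ?_
  exact ENNReal.ofReal_tsum_of_nonneg (hnn t)
    ((summable_lateBound hp).of_nonneg_of_le (hnn t) fun n => min_le_right _ _)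

/-- A flip in opposition raises the energy by at least `2`. So, from any starting configuration, it
can only occur at an arrival `τ ≥ t` whose mark is below `τ ^ (-p)`: a condition on the clocks alone,
which no longer involves the process. -/
lemma encard_oppositionFlips_le {T : ℝ≥0 → ℝ≥0} {p : ℝ} {t : ℝ≥0}
    (h : ∀ r ≥ t, ∀ δ : ℤ, 2 ≤ δ → rate (T r) δ ≤ (r : ℝ) ^ (-p)) (J : G.Interactions)
    (ξ : G.Config) (x : G.V) (ω : Sample G k) :
    (((oppositionFlips T J t ξ ω x ∩ Set.Ici t).encard : ℕ∞) : ℝ≥0∞) ≤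
      ∑' q : {A : Region G k // x ∈ A.1} × ℕ, {ω | t ≤ arrival ω q.1.1 q.2 ∧
        mark ω q.1.1 q.2 < (arrival ω q.1.1 q.2 : ℝ) ^ (-p)}.indicator 1 ω := by
  set s : Set ({A : Region G k // x ∈ A.1} × ℕ) :=
    {q | t ≤ arrival ω q.1.1 q.2 ∧ mark ω q.1.1 q.2 < (arrival ω q.1.1 q.2 : ℝ) ^ (-p)}
  have hsub : oppositionFlips T J t ξ ω x ∩ Set.Ici t ⊆ (fun q => arrival ω q.1.1 q.2) '' s := by
    rintro r ⟨hr, -⟩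
    simp only [oppositionFlips, Set.mem_iUnion] at hr
    obtain ⟨A, hA, htr, ⟨n, hn, hmark⟩, hpos⟩ := hr
    refine ⟨(⟨A, hA⟩, n), ⟨hn ▸ htr, ?_⟩, hn⟩
    rw [hn]
    exact hmark.trans_le (h r htr _ (two_le_deltaH_of_pos hpos))
  calc (((oppositionFlips T J t ξ ω x ∩ Set.Ici t).encard : ℕ∞) : ℝ≥0∞) ≤ (s.encard : ℕ∞) := by
        exact_mod_cast (Set.encard_le_encard hsub).trans (Set.encard_image_le _ _)
    _ = ∑' q, s.indicator 1 q := by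
        rw [← ENNReal.tsum_set_one, tsum_subtype s (fun _ => (1 : ℝ≥0∞))]; rfl

lemma expectedOpposition_le {T : ℝ≥0 → ℝ≥0} {p : ℝ} (hp : 0 < p) {t : ℝ≥0} (ht : 0 < t)
    (h : ∀ r ≥ t, ∀ δ : ℤ, 2 ≤ δ → rate (T r) δ ≤ (r : ℝ) ^ (-p)) (J : G.Interactions)
    (ξ : G.Config) (x : G.V) :
    expectedOpposition T k J x t ξ ≤ (ENat.card {A : Region G k // x ∈ A.1} : ℝ≥0∞) *
      ∑' n, ENNReal.ofReal (min ((t : ℝ) ^ (-p)) (lateBound p n)) := by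
  have := finite_region_mem (G := G) x k
  set E : Region G k → ℕ → Set (Sample G k) := fun A n =>
    {ω | t ≤ arrival ω A n ∧ mark ω A n < (arrival ω A n : ℝ) ^ (-p)}
  have hms : ∀ A n, MeasurableSet (E A n) := fun A n =>
    (measurableSet_le measurable_const (measurable_arrival A n)).inter
      (measurableSet_lt (measurable_mark A n) (by fun_prop))
  have hind : ∀ A n, Measurable ((E A n).indicator (1 : Sample G k → ℝ≥0∞)) := fun A n =>
    measurable_one.indicator (hms A n)
  calc expectedOpposition T k J x t ξ
      ≤ ∫⁻ ω, ∑' q : {A : Region G k // x ∈ A.1} × ℕ, (E q.1.1 q.2).indicator 1 ω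
          ∂(harrisMeasure G k) := lintegral_mono fun ω => encard_oppositionFlips_le h J ξ x ω
    _ = ∑' q : {A : Region G k // x ∈ A.1} × ℕ, harrisMeasure G k (E q.1.1 q.2) := by
        have hae : ∀ q : {A : Region G k // x ∈ A.1} × ℕ,
            AEMeasurable ((E q.1.1 q.2).indicator (1 : Sample G k → ℝ≥0∞)) (harrisMeasure G k) :=
          fun q => (hind q.1.1 q.2).aemeasurable
        rw [lintegral_tsum hae]
        exact tsum_congr fun q => lintegral_indicator_one (hms q.1.1 q.2)
    _ = ∑' (A : {A : Region G k // x ∈ A.1}) (n : ℕ), harrisMeasure G k (E A.1 n) :=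
        ENNReal.tsum_prod'
    _ ≤ ∑' _ : {A : Region G k // x ∈ A.1},
          ∑' n, ENNReal.ofReal (min ((t : ℝ) ^ (-p)) (lateBound p n)) :=
        ENNReal.tsum_le_tsum fun A => ENNReal.tsum_le_tsum fun n => measure_late_le hp A.1 n ht
    _ = _ := ENNReal.tsum_const _

/-- The exponent is `p = 4 / a`, where `T(t) log t < a < 4` for large `t`; thus `p > 1`. -/
theorem fastDecreasing_of_limsup_lt {T : ℝ≥0 → ℝ≥0}
    (h : limsup (fun t : ℝ≥0 => (((T t : ℝ) * Real.log (t : ℝ) : ℝ) : EReal)) atTop < 4) :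
    FastDecreasing G T := by
  intro x k _ J
  obtain ⟨a, ha, ha4⟩ := EReal.lt_iff_exists_real_btwn.1 h
  have ha4 : a < 4 := by
    rw [← EReal.coe_lt_coe_iff]
    exact ha4
  -- `a` may be nonpositive, when `T` vanishes for instance, so it is replaced by `max a 1`.
  have hb0 : 0 < max a 1 := by positivity
  have hp : 1 < 4 / max a 1 := (one_lt_div hb0).2 (max_lt ha4 (by norm_num))
  obtain ⟨t₀, ht₀⟩ := eventually_atTop.1 (eventually_lt_of_limsup_lt ha)
  have := finite_region_mem (G := G) x k
  have hlim := ENNReal.Tendsto.const_mul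
    (a := (ENat.card {A : Region G k // x ∈ A.1} : ℝ≥0∞)) (tendsto_tsum_min_lateBound hp)
    (Or.inr (by simp [ENat.card_eq_coe_natCard]))
  rw [mul_zero] at hlim
  refine tendsto_of_tendsto_of_tendsto_of_le_of_le' tendsto_const_nhds hlim
    (Eventually.of_forall fun _ => zero_le) ?_
  filter_upwards [eventually_ge_atTop t₀, eventually_gt_atTop 0] with t ht htpos
  refine iSup_le fun ξ => expectedOpposition_le (by linarith) htpos (fun r hr δ hδ => ?_) J ξ x
  refine rate_le_rpow hδ (by exact_mod_cast htpos.trans_le hr) hb0 ?_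
  have hlt : (T r : ℝ) * Real.log r < a := by exact_mod_cast ht₀ r (ht.trans hr)
  exact hlt.le.trans (le_max_left _ _)

/-! ### Infinitely many flips -/

/-- The set `{x}` as a member of `𝒜_k`. -/
def singletonRegion (hk : 1 ≤ k) (x : G.V) : Region G k :=
  ⟨{x}, by simpa using hk, by
    rw [Finset.coe_singleton, SimpleGraph.induce_singleton_eq_top]
    exact SimpleGraph.connected_top⟩

lemma FlipAt.mem_totalFlips {T : ℝ≥0 → ℝ≥0} {J : G.Interactions} {s r : ℝ≥0} {ξ : G.Config}
    {ω : Sample G k} {x : G.V} {A : Region G k} (hx : x ∈ A.1) (hr : s ≤ r)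
    (h : FlipAt T J ω A r (process T J s ξ ω r)) : r ∈ totalFlips T J s ξ ω x := by
  rcases lt_trichotomy 0 (deltaH J (A.1 : Set G.V) (process T J s ξ ω r)) with hδ | hδ | hδ
  · exact Or.inl (Or.inl (Set.mem_biUnion (x := A) hx ⟨hr, h, hδ⟩))
  · exact Or.inl (Or.inr (Set.mem_biUnion (x := A) hx ⟨hr, h, hδ.symm⟩))
  · exact Or.inr (Set.mem_biUnion (x := A) hx ⟨hr, h, hδ⟩)

/-- An arrival of the clock of `{x}` with a mark below the deterministic sequence `u` produces a flip
of `x` whatever the configuration is, as soon as the arrival time is large and of the typical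
order. -/
theorem ae_infinite_totalFlips {T : ℝ≥0 → ℝ≥0} (hk : 1 ≤ k) (J : G.Interactions)
    (σ : G.Config) (x : G.V)
    (h : ((4 * (G.deg x : ℝ) : ℝ) : EReal) <
      liminf (fun t : ℝ≥0 => (((T t : ℝ) * Real.log (t : ℝ) : ℝ) : EReal)) atTop) :
    ∀ᵐ ω ∂(harrisMeasure G k), (totalFlips T J 0 σ ω x).Infinite := by
  obtain ⟨a, ha', ha⟩ := EReal.lt_iff_exists_real_btwn.1 h
  have ha' : 4 * (G.deg x : ℝ) < a := by exact_mod_cast ha'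
  have ha0 : 0 < a := lt_of_le_of_lt (by positivity) ha'
  obtain ⟨t₀, ht₀⟩ := eventually_atTop.1 (eventually_lt_of_lt_liminf ha)
  set b : ℝ := 4 * G.deg x / a
  have hb0 : 0 ≤ b := by positivity
  have hb1 : b < 1 := (div_lt_one ha0).2 ha'
  set A : Region G k := singletonRegion hk x
  -- The bound `τ ^ (-b) / 2` of `rpow_le_rate` at `τ = 2 (n + 1)`, which exceeds the `n`-th arrival
  -- time for large `n`. The marks are compared with `u` and not with this bound at the arrival time
  -- itself, so that the events are independent.
  set u : ℕ → ℝ := fun n => 1 / 2 * (2 * (n + 1 : ℝ)) ^ (-b) with hu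
  have hu1 : ∀ n, u n ≤ 1 := fun n => by
    have : (2 * (n + 1 : ℝ)) ^ (-b) ≤ 1 :=
      Real.rpow_le_one_of_one_le_of_nonpos (by linarith [n.cast_nonneg (α := ℝ)]) (by linarith)
    simp only [hu]; linarith
  have hsum : ¬ Summable u := by
    intro hs
    have h1 : Summable fun n : ℕ => ((n + 1 : ℕ) : ℝ) ^ (-b) := by
      refine (hs.mul_left (2 * 2⁻¹ ^ (-b))).congr fun n => ?_
      rw [mul_mul_mul_comm, mul_one_div_cancel (by norm_num), one_mul,
        ← Real.mul_rpow (by positivity) (by positivity), inv_mul_cancel_left₀ (by norm_num)]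
      push_cast
      rfl
    linarith [Real.summable_nat_rpow.1 ((summable_nat_add_iff 1).1 h1)]
  filter_upwards [ae_eventually_arrival A,
    ae_frequently_mark_lt A (fun n => by simp only [hu]; positivity) hu1 hsum] with ω hω hfreq
  have htend : Tendsto (fun n => arrival ω A n) atTop atTop := by
    rw [← NNReal.tendsto_coe_atTop]
    refine tendsto_atTop_mono' _ (hω.mono fun n hn => hn.1.le) ?_
    exact (tendsto_natCast_atTop_atTop.atTop_add tendsto_const_nhds).atTop_div_const (by norm_num)
  have hmem : ∃ᶠ n in atTop, arrival ω A n ∈ totalFlips T J 0 σ ω x := by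
    refine (hfreq.and_eventually (hω.and (htend.eventually_ge_atTop (max t₀ 1)))).mono ?_
    rintro n ⟨hmark, ⟨-, hlt⟩, hge⟩
    have hge1 : (1 : ℝ) ≤ arrival ω A n := by exact_mod_cast (le_max_right _ _).trans hge
    have hT : a < T (arrival ω A n) * Real.log (arrival ω A n) := by
      exact_mod_cast ht₀ _ ((le_max_left _ _).trans hge)
    refine FlipAt.mem_totalFlips (A := A) (Finset.mem_singleton_self x) zero_le
      ⟨n, rfl, hmark.trans_le ?_⟩
    have hcoe : ((A.1 : Finset G.V) : Set G.V) = {x} := Finset.coe_singleton x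
    rw [hcoe]
    refine le_trans ?_ (rpow_le_rate (deltaH_singleton_le J x _) hge1 ha0 hT.le)
    exact mul_le_mul_of_nonneg_left
      (Real.rpow_le_rpow_of_nonpos (by linarith) hlt.le (by linarith)) (by norm_num)
  -- Arrival times tend to infinity, so a finite set contains only finitely many of them.
  intro hfin
  obtain ⟨M, hM⟩ := hfin.bddAbove
  obtain ⟨n, hn, hn'⟩ := (hmem.and_eventually (htend.eventually_gt_atTop M)).exists
  exact (hM hn).not_gt hn'

end Ising

theorem mainTheorem2 {d : ℕ} (G : Ising.DGraph d) (T : ℝ≥0 → ℝ≥0) (hT : Measurable T) :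
    (limsup (fun t : ℝ≥0 => (((T t : ℝ) * Real.log (t : ℝ) : ℝ) : EReal)) atTop < 4 →
      Ising.FastDecreasing G T) ∧
    (∀ (k : ℕ), 1 ≤ k → ∀ (J : G.Interactions) (σ : G.Config) (x : G.V),
      ((4 * (G.deg x : ℝ) : ℝ) : EReal) <
        liminf (fun t : ℝ≥0 => (((T t : ℝ) * Real.log (t : ℝ) : ℝ) : EReal)) atTop →
      ∀ᵐ ω ∂(Ising.harrisMeasure G k), (Ising.totalFlips T J 0 σ ω x).Infinite) :=
  ⟨Ising.fastDecreasing_of_limsup_lt, fun _ hk J σ x h =>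
    Ising.ae_infinite_totalFlips hk J σ x h⟩
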